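/- Let $n\ge 1$. A ménage permutation in $S_n$ is a permutation $\pi\in S_n$ with $\pi(i)\ne i$ and $\pi(i)+1\not\equiv i \pmod n$ for all $i\in[n]$. Let $\ell\ge 1$ and let $\alpha=(\alpha_1,\dots,\alpha_\ell)$ be a word of distinct letters in $[n]$ with $\alpha_i\ne i$ and $\alpha_i+1\not\equiv i\pmod n$ for all $i\in[\ell]$ (a valid nonempty prefix). A board is a set of squares (row, column) of a chessboard, and its rook number $r_k$ is the number of its $k$-element subsets in which no two squares share a row or a column. Let $B=\{(i,j)\in[n]^2 : j\neq i,\ j+1\not\equiv i \pmod n\}$. The derived board $B_\alpha$ is obtained from $B$ by removing rows $1,\dots,\ell$ and columns $\alpha_1,\dots,\alpha_\ell$ and reindexing the remaining rows and columns in increasing order by $[n-\ell]$. Let $B_\alpha^c=[n-\ell]^2\setminus B_\alpha$ be the derived complementary board and let $r_k^c$ be its rook numbers. For $1 \le i\le n$ put $c_i=0$ if $i<\ell$, $c_i=1$ if $i=\ell$ or $i=n$, and $c_i=2$ if $\ell<i<n$. Partition $[n]\setminus\{\alpha_1,\dots,\alpha_\ell\}$ into its maximal contiguous parts $P_1,\dots,P_m$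 (intervals of consecutive integers), and let $\mathcal P_\alpha$ be the multiset of the numbers $\sum_{i\in P_j}c_i$, $j=1,\dots,m$. The Fibonacci polynomials are $F_0=1$, $F_1=1+x$, $F_j=xF_{j-2}+F_{j-1}$ for $j\ge2$. A board is staircase-shaped if, for some $s\ge 1$, it is a translate of one of $$\{(i,i):i\in[s]\}\cup\{(i,i+1):i\in[s-1]\},\qquad \{(i,i):i\in[s]\}\cup\{(i+1,i):i\in[s-1]\},$$ $$\{(i,i):i\in[s-1]\}\cup\{(i+1,i):i\in[s-1]\},\qquad \{(i,i):i\in[s-1]\}\cup\{(i,i+1):i\in[s-1]\}.$$ Theorem. The board $B_\alpha^c$ is the union of staircase-shaped boards $b_1,\dots,b_m$ such that no square of $b_j$ shares a row or a column with a square of $b_{j'}$ for $j\ne j'$, and $b_j$ has $\sum_{i\in P_j}c_i$ squares for each $j$. Moreover, $$\sum_{k=0}^{n-\ell} r_k^c\,x^k=\prod_{p\in\mathcal P_\alpha}F_p(x),$$ and the number of ménage permutations in $S_n$ that begin with $\alpha$ is $$\sum_{k=0}^{n-\ell}(-1)^k\,r_k^c\,(n-\ell-k)!\,.$$ -/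

import Mathlib

open Finset Polynomial

namespace Menage

/-! Rows, columns and letters `1, …, n` are represented by `Fin n`, so the element `i : Fin n`
stands for the number `i + 1`. A square is a pair (row, column). -/

/-! ### Ménage permutations and prefixes -/

/-- The letter `j` is allowed at position `i`: `j ≠ i` and `j + 1 ≢ i (mod n)`. -/
def Allowed {n : ℕ} (i j : Fin n) : Prop :=
  j ≠ i ∧ ¬ ((j : ℕ) + 1 ≡ (i : ℕ) [MOD n])

instance {n : ℕ} (i j : Fin n) : Decidable (Allowed i j) := by
  unfold Allowed; infer_instance

/-- The set of ménage permutations of length `n`. -/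
def menagePerms (n : ℕ) : Finset (Equiv.Perm (Fin n)) :=
  {π | ∀ i, Allowed i (π i)}

/-- The word `π(1) π(2) … π(n)` begins with the prefix `α`. -/
def BeginsWith {n ℓ : ℕ} (π : Equiv.Perm (Fin n)) (α : Fin ℓ ↪ Fin n) : Prop :=
  ∃ h : ℓ ≤ n, ∀ i : Fin ℓ, π (Fin.castLE h i) = α i

instance {n ℓ : ℕ} (π : Equiv.Perm (Fin n)) (α : Fin ℓ ↪ Fin n) :
    Decidable (BeginsWith π α) := by
  unfold BeginsWith; infer_instance

/-- The number of ménage permutations that begin with `α`. -/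
def prefixCount {n ℓ : ℕ} (α : Fin ℓ ↪ Fin n) : ℕ :=
  #{π ∈ menagePerms n | BeginsWith π α}

theorem length_le {n ℓ : ℕ} (α : Fin ℓ ↪ Fin n) : ℓ ≤ n := by
  simpa using Fintype.card_le_of_embedding α

/-- A word with distinct letters is a valid prefix if each of its letters is allowed at its
position. (It need not extend to a ménage permutation.) -/
def ValidPrefix {n ℓ : ℕ} (α : Fin ℓ ↪ Fin n) : Prop :=
  ∀ i : Fin ℓ, Allowed (Fin.castLE (length_le α) i) (α i)

/-! ### Boards and rook polynomials -/

/-- Boards on an `m × m` chessboard. -/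
abbrev Board (m : ℕ) := Finset (Fin m × Fin m)

/-- No two squares of `S` share a row or a column. -/
def NonAttacking {m : ℕ} (S : Board m) : Prop :=
  ∀ p ∈ S, ∀ q ∈ S, p ≠ q → p.1 ≠ q.1 ∧ p.2 ≠ q.2

instance {m : ℕ} (S : Board m) : Decidable (NonAttacking S) := by
  unfold NonAttacking; infer_instance

/-- The number of ways to place `k` nonattacking rooks on `B`. -/
def rookNumber {m : ℕ} (B : Board m) (k : ℕ) : ℕ :=
  #{S ∈ B.powersetCard k | NonAttacking S}

/-- The rook polynomial of a board inside an `m × m` chessboard. -/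
noncomputable def rookPolynomial {m : ℕ} (B : Board m) : ℤ[X] :=
  ∑ k ∈ range (m + 1), C (rookNumber B k : ℤ) * X ^ k

/-- The board of all squares allowed for ménage permutations. -/
def menageBoard (n : ℕ) : Board n :=
  univ.filter fun p => Allowed p.1 p.2

/-- The columns that are not letters of `α`. -/
def freeColumns {n ℓ : ℕ} (α : Fin ℓ ↪ Fin n) : Finset (Fin n) := (univ.map α)ᶜ

theorem card_freeColumns {n ℓ : ℕ} (α : Fin ℓ ↪ Fin n) : #(freeColumns α) = n - ℓ := by
  simp [freeColumns, card_compl]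

/-- The row of the original board that becomes row `i` after the first `ℓ` rows are removed. -/
def oldRow {n ℓ : ℕ} (i : Fin (n - ℓ)) : Fin n := ⟨ℓ + i, by omega⟩

/-- The column of the original board that becomes column `j` after the columns of `α` are
removed: the `j`-th smallest of the remaining columns. -/
def oldColumn {n ℓ : ℕ} (α : Fin ℓ ↪ Fin n) (j : Fin (n - ℓ)) : Fin n :=
  (freeColumns α).orderEmbOfFin (card_freeColumns α) j

/-- The derived board `B_α`: remove the first `ℓ` rows and the columns of `α`, and reindex. -/
def derivedBoard {n ℓ : ℕ} (B : Board n) (α : Fin ℓ ↪ Fin n) : Board (n - ℓ) :=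
  univ.filter fun p => (oldRow p.1, oldColumn α p.2) ∈ B

/-- The derived complementary board of the ménage board from `α`. -/
def derivedComplement {n ℓ : ℕ} (α : Fin ℓ ↪ Fin n) : Board (n - ℓ) :=
  (derivedBoard (menageBoard n) α)ᶜ

/-! ### Staircase-shaped boards -/

/-- The four staircase shapes with parameter `s ≥ 1`, with `2s-1`, `2s-1`, `2s-2` and `2s-2`
squares, placed with upper left corner `(0, 0)`. -/
def stairO (s : ℕ) : Finset (ℕ × ℕ) :=
  (range s).image (fun i => (i, i)) ∪ (range (s - 1)).image (fun i => (i, i + 1))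

/-- A staircase shape; see `stairO`. -/
def stairOT (s : ℕ) : Finset (ℕ × ℕ) :=
  (range s).image (fun i => (i, i)) ∪ (range (s - 1)).image (fun i => (i + 1, i))

/-- A staircase shape; see `stairO`. -/
def stairE (s : ℕ) : Finset (ℕ × ℕ) :=
  (range (s - 1)).image (fun i => (i, i)) ∪ (range (s - 1)).image (fun i => (i + 1, i))

/-- A staircase shape; see `stairO`. -/
def stairET (s : ℕ) : Finset (ℕ × ℕ) :=
  (range (s - 1)).image (fun i => (i, i)) ∪ (range (s - 1)).image (fun i => (i, i + 1))

/-- `b` is a translate of one of the four staircase shapes. -/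
def IsStaircase {m : ℕ} (b : Board m) : Prop :=
  ∃ s r c : ℕ, 1 ≤ s ∧ ∃ T ∈ [stairO s, stairOT s, stairE s, stairET s],
    b.image (fun p => ((p.1 : ℕ), (p.2 : ℕ))) = T.image (fun p => (p.1 + r, p.2 + c))

/-- Disjoint boards: no square of `b` is in the same row or column as a square of `b'`. -/
def DisjointBoards {m : ℕ} (b b' : Board m) : Prop :=
  ∀ p ∈ b, ∀ q ∈ b', p.1 ≠ q.1 ∧ p.2 ≠ q.2

/-! ### Block sizes and Fibonacci polynomials -/

/-- The partition of a set of numbers into its contiguous parts: the part of `i ∈ S` consists of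
all `j ∈ S` such that every number between `i` and `j` is in `S`. -/
def contiguousParts {n : ℕ} (S : Finset (Fin n)) : Finset (Finset (Fin n)) :=
  S.image fun i => {j ∈ S | uIcc i j ⊆ S}

/-- The number `c_i` of forbidden squares below row `ℓ` in column `i`; here `1 ≤ i ≤ n`. -/
def columnSize (n ℓ i : ℕ) : ℕ :=
  if i < ℓ then 0 else if i = ℓ ∨ i = n then 1 else 2

/-- The size of the block that corresponds to a contiguous part `P`. -/
def blockSize {n : ℕ} (ℓ : ℕ) (P : Finset (Fin n)) : ℕ :=
  ∑ i ∈ P, columnSize n ℓ ((i : ℕ) + 1)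

/-- The multiset of block sizes of a prefix. -/
def blockSizes {n ℓ : ℕ} (α : Fin ℓ ↪ Fin n) : Multiset ℕ :=
  (contiguousParts (freeColumns α)).val.map (blockSize ℓ)

/-- `F_0 = 1`, `F_1 = 1 + x`, `F_n = x F_{n-2} + F_{n-1}`. -/
noncomputable def fibPoly : ℕ → ℤ[X]
  | 0 => 1
  | 1 => 1 + X
  | n + 2 => X * fibPoly n + fibPoly (n + 1)

/-- The family `b P`, indexed by the contiguous parts `P` of the remaining columns, partitions the
derived complementary board into disjoint staircase-shaped boards. -/
structure IsBlockDecomposition {n ℓ : ℕ} (α : Fin ℓ ↪ Fin n)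
    (b : Finset (Fin n) → Board (n - ℓ)) : Prop where
  staircase : ∀ P ∈ contiguousParts (freeColumns α), IsStaircase (b P)
  disjoint : ∀ P ∈ contiguousParts (freeColumns α), ∀ Q ∈ contiguousParts (freeColumns α),
    P ≠ Q → DisjointBoards (b P) (b Q)
  union : (contiguousParts (freeColumns α)).biUnion b = derivedComplement α

end Menage

namespace Menage

/-! ### Permutations through prescribed squares -/

/-! With 0-based coordinates, row `i ≥ 1` has exactly the forbidden squares `(i, i)` and `(i, i -
1)`; only row `0` wraps around, and `ℓ ≥ 1` removes it. The forbidden squares thus form a chain `(0,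
0), (1, 0), (1, 1), (2, 1), …`, where the square at position `t` is `((t + 1) / 2, t / 2)` and has
coordinate sum `t`. Two of them attack each other iff their positions are consecutive
(`not_attack_iff`), so rook placements are independent sets of a path.

Deleting the first rows truncates the path, and deleting columns cuts it. A contiguous part of the
free columns keeps an interval of positions, hence a staircase (`isStaircase_block`), and different
parts do not interact (`disjointBoards_block`). The independence polynomial `pairPoly` is
multiplicative over such pieces, and a path with `N` vertices contributes `fibPoly N`
(`pairPoly_Ico`).

The count is inclusion–exclusion over the forbidden squares hit (`prefixCount_eq`): a nonattacking
set of `k` of them, together with the prefix, extends to `(n - ℓ - k)!` permutations. -/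

theorem card_perm_eqOn {α : Type*} [Fintype α] [DecidableEq α] (s : Finset α)
    (τ : Equiv.Perm α) :
    #{σ : Equiv.Perm α | ∀ i ∈ s, σ i = τ i} = (Fintype.card α - #s).factorial := by
  have h1 : #{σ : Equiv.Perm α | ∀ i ∈ s, σ i = τ i} =
      #{σ : Equiv.Perm α | ∀ i, ¬ i ∉ s → σ i = i} := by
    -- Composing with `τ⁻¹` turns agreement with `τ` on `s` into fixing `s` pointwise, which leaves
    -- a permutation of the complement.
    refine card_equiv (Equiv.mulLeft τ⁻¹) fun σ => ?_
    simp [Equiv.symm_apply_eq]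
  rw [h1, ← Fintype.card_subtype,
    ← Fintype.card_congr (Equiv.Perm.subtypeEquivSubtypePerm fun i => i ∉ s),
    Fintype.card_perm]
  simp

/-- A nonattacking set is the graph of an injective partial function, and on a finite set this
extends to a permutation. -/
theorem NonAttacking.exists_perm {m : ℕ} {S : Board m} (h : NonAttacking S) :
    ∃ τ : Equiv.Perm (Fin m), ∀ p ∈ S, τ p.1 = p.2 := by
  have hf : ∀ i : {i // i ∈ S.image Prod.fst}, ∃ j, (i.1, j) ∈ S := by
    rintro ⟨i, hi⟩
    obtain ⟨p, hp, rfl⟩ := mem_image.1 hi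
    exact ⟨p.2, hp⟩
  choose f hf using hf
  have hinj : Function.Injective f := by
    intro i j hij
    by_contra hne
    refine (h _ (hf i) _ (hf j) fun h' => hne (Subtype.ext (congrArg Prod.fst h'))).2 hij
  obtain ⟨τ, hτ⟩ := Equiv.Perm.exists_extending_pair (Subtype.val : {i // i ∈ S.image Prod.fst} → _)
    f Subtype.val_injective hinj
  refine ⟨τ, fun p hp => ?_⟩
  have hp' := mem_image_of_mem Prod.fst hp
  rw [hτ ⟨p.1, hp'⟩]
  by_contra hne
  exact (h _ (hf ⟨p.1, hp'⟩) _ hp fun h' => hne (congrArg Prod.snd h')).1 rfl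

theorem NonAttacking.injOn_fst {m : ℕ} {S : Board m} (h : NonAttacking S) :
    Set.InjOn Prod.fst (S : Set (Fin m × Fin m)) := by
  intro p hp q hq hpq
  by_contra hne
  exact (h p hp q hq hne).1 hpq

/-- The number of permutations whose graph contains `S`. -/
theorem card_perm_graph_superset {m : ℕ} (S : Board m) :
    #{σ : Equiv.Perm (Fin m) | ∀ p ∈ S, σ p.1 = p.2} =
      if NonAttacking S then (m - #S).factorial else 0 := by
  split_ifs with h
  · obtain ⟨τ, hτ⟩ := h.exists_perm
    have := card_perm_eqOn (S.image Prod.fst) τ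
    rw [card_image_of_injOn h.injOn_fst, Fintype.card_fin] at this
    rw [← this]
    congr 1
    ext σ
    simp only [mem_filter, mem_univ, true_and, forall_mem_image]
    exact forall₂_congr fun p hp => by rw [hτ p hp]
  · rw [card_eq_zero, filter_eq_empty_iff]
    intro σ _ hσ
    refine h fun p hp q hq hpq => ⟨fun h1 => hpq ?_, fun h2 => hpq ?_⟩
    · exact Prod.ext h1 (by rw [← hσ p hp, ← hσ q hq, h1])
    · exact Prod.ext (σ.injective (by rw [hσ p hp, hσ q hq, h2])) h2

theorem NonAttacking.card_le {m : ℕ} {S : Board m} (h : NonAttacking S) : #S ≤ m := by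
  rw [← card_image_of_injOn h.injOn_fst]
  simpa using card_le_univ (S.image Prod.fst)

/-- Sorting the nonattacking placements on a board by their number of rooks. -/
theorem sum_nonAttacking {m : ℕ} {R : Type*} [CommRing R] (B : Board m) (f : ℕ → R) :
    ∑ S ∈ B.powerset with NonAttacking S, f #S =
      ∑ k ∈ range (m + 1), (rookNumber B k : R) * f k := by
  rw [← sum_fiberwise_of_maps_to (t := range (m + 1)) (g := fun S : Board m => #S)
    fun S hS => by have := (mem_filter.1 hS).2.card_le; simp; omega]
  refine sum_congr rfl fun k _ => ?_
  rw [rookNumber, sum_congr rfl (g := fun _ => f k)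
    (fun S hS => by rw [(mem_filter.1 hS).2]), sum_const, nsmul_eq_mul]
  congr 3
  ext S
  simp only [mem_filter, mem_powerset, mem_powersetCard]
  tauto

/-! ### Reindexing of the free columns. -/

theorem oldColumn_strictMono {n ℓ : ℕ} (α : Fin ℓ ↪ Fin n) : StrictMono (oldColumn α) :=
  OrderEmbedding.strictMono _

theorem oldColumn_mem {n ℓ : ℕ} (α : Fin ℓ ↪ Fin n) (j : Fin (n - ℓ)) :
    oldColumn α j ∈ freeColumns α := orderEmbOfFin_mem _ _ _

theorem exists_oldColumn {n ℓ : ℕ} (α : Fin ℓ ↪ Fin n) {x : Fin n} (hx : x ∈ freeColumns α) :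
    ∃ j, oldColumn α j = x := by
  have : x ∈ Set.range ((freeColumns α).orderEmbOfFin (card_freeColumns α)) := by
    rw [range_orderEmbOfFin]; exact hx
  exact this

theorem mem_freeColumns {n ℓ : ℕ} {α : Fin ℓ ↪ Fin n} {x : Fin n} :
    x ∈ freeColumns α ↔ ∀ i, α i ≠ x := by
  simp [freeColumns]

/-! ### Counting by inclusion and exclusion -/

/-- The square of the original board that becomes `p` in the derived board. -/
def oldSquare {n ℓ : ℕ} (α : Fin ℓ ↪ Fin n) : Fin (n - ℓ) × Fin (n - ℓ) ↪ Fin n × Fin n where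
  toFun p := (oldRow p.1, oldColumn α p.2)
  inj' p q h := by
    simp only [Prod.mk.injEq, oldRow, Fin.mk.injEq] at h
    exact Prod.ext (Fin.ext (by omega)) ((oldColumn_strictMono α).injective h.2)

@[simp]
theorem oldSquare_apply {n ℓ : ℕ} (α : Fin ℓ ↪ Fin n) (p : Fin (n - ℓ) × Fin (n - ℓ)) :
    oldSquare α p = (oldRow p.1, oldColumn α p.2) := rfl

/-- The squares occupied by a prefix. -/
def prefixSquares {n ℓ : ℕ} (α : Fin ℓ ↪ Fin n) : Board n :=
  univ.image fun i => (Fin.castLE (length_le α) i, α i)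

theorem card_prefixSquares {n ℓ : ℕ} (α : Fin ℓ ↪ Fin n) : #(prefixSquares α) = ℓ := by
  rw [prefixSquares, card_image_of_injective _ fun i j h => α.injective (congrArg Prod.snd h)]
  simp

theorem beginsWith_iff {n ℓ : ℕ} {α : Fin ℓ ↪ Fin n} {π : Equiv.Perm (Fin n)} :
    BeginsWith π α ↔ ∀ p ∈ prefixSquares α, π p.1 = p.2 := by
  simp [BeginsWith, prefixSquares, length_le α]

theorem disjoint_prefixSquares {n ℓ : ℕ} (α : Fin ℓ ↪ Fin n) (S : Board (n - ℓ)) :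
    Disjoint (prefixSquares α) (S.map (oldSquare α)) := by
  rw [disjoint_left]
  intro p hp hq
  obtain ⟨i, -, rfl⟩ := mem_image.1 hp
  obtain ⟨q, -, hq⟩ := mem_map.1 hq
  exact mem_freeColumns.1 (oldColumn_mem α q.2) i (congrArg Prod.snd hq).symm

theorem nonAttacking_prefix_union {n ℓ : ℕ} (α : Fin ℓ ↪ Fin n) (S : Board (n - ℓ)) :
    NonAttacking (prefixSquares α ∪ S.map (oldSquare α)) ↔ NonAttacking S := by
  constructor
  · intro h p hp q hq hpq
    have := h (oldSquare α p) (mem_union_right _ (mem_map_of_mem _ hp)) (oldSquare α q)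
      (mem_union_right _ (mem_map_of_mem _ hq))
      fun h' => hpq ((oldSquare α).injective h')
    exact ⟨fun h' => this.1 (by simp [h']), fun h' => this.2 (by simp [h'])⟩
  · intro h p hp q hq hpq
    simp only [mem_union, mem_map, prefixSquares, mem_image, mem_univ, true_and] at hp hq
    rcases hp with ⟨i, rfl⟩ | ⟨p, hp, rfl⟩ <;> rcases hq with ⟨j, rfl⟩ | ⟨q, hq, rfl⟩
    · have hij : i ≠ j := by rintro rfl; exact hpq rfl
      exact ⟨fun h' => hij (Fin.castLE_injective (length_le α) h'), fun h' => hij (α.injective h')⟩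
    · refine ⟨fun h' => ?_, mem_freeColumns.1 (oldColumn_mem α q.2) i⟩
      have := congrArg Fin.val h'
      simp [oldRow] at this
      omega
    · refine ⟨fun h' => ?_, (mem_freeColumns.1 (oldColumn_mem α p.2) j).symm⟩
      have := congrArg Fin.val h'
      simp [oldRow] at this
      omega
    · have := h p hp q hq fun h' => hpq (by rw [h'])
      refine ⟨fun h' => this.1 (Fin.ext ?_), fun h' => this.2 ((oldColumn_strictMono α).injective h')⟩
      have := congrArg Fin.val h'
      simp only [oldSquare_apply, oldRow] at this
      omega

/-- The squares of the derived complementary board that a permutation hits. -/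
def hitSquares {n ℓ : ℕ} (α : Fin ℓ ↪ Fin n) (π : Equiv.Perm (Fin n)) : Board (n - ℓ) :=
  {p ∈ derivedComplement α | π (oldRow p.1) = oldColumn α p.2}

/-- Validity of `α` settles the first `ℓ` positions. At later positions the values are free columns,
so each violation is a square of the derived complement. -/
theorem mem_menagePerms_iff {n ℓ : ℕ} {α : Fin ℓ ↪ Fin n} (hα : ValidPrefix α)
    {π : Equiv.Perm (Fin n)} (hπ : BeginsWith π α) :
    π ∈ menagePerms n ↔ hitSquares α π = ∅ := by
  obtain ⟨hle, hπ⟩ := hπ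
  simp only [menagePerms, mem_filter, mem_univ, true_and, hitSquares, filter_eq_empty_iff,
    derivedComplement, derivedBoard, mem_compl, menageBoard]
  constructor
  · intro h p hp hp'
    exact hp (hp' ▸ h _)
  · intro h i
    by_cases hi : (i : ℕ) < ℓ
    · have := hα ⟨i, hi⟩
      rwa [← hπ ⟨i, hi⟩] at this
    · have hfree : π i ∈ freeColumns α := mem_freeColumns.2 fun j hj => by
        rw [← hπ j] at hj
        have := congrArg Fin.val (π.injective hj)
        simp at this
        omega
      obtain ⟨j, hj⟩ := exists_oldColumn α hfree
      have hrow : oldRow (⟨i - ℓ, by omega⟩ : Fin (n - ℓ)) = i := Fin.ext (by simp [oldRow]; omega)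
      by_contra hA
      refine @h (⟨i - ℓ, by omega⟩, j) ?_ ?_
      · rw [hrow, hj]; exact hA
      · rw [hrow, hj]

/-- The alternating sum over subsets of `hitSquares α π` is the indicator that this set is empty.
Exchanging the sums leaves, for each `S`, the permutations through `S` and the prefix squares. -/
theorem prefixCount_eq {n ℓ : ℕ} {α : Fin ℓ ↪ Fin n} (hα : ValidPrefix α) :
    (prefixCount α : ℤ) =
      ∑ k ∈ range (n - ℓ + 1),
        (-1) ^ k * (rookNumber (derivedComplement α) k : ℤ) * ((n - ℓ - k).factorial : ℤ) := by
  have h1 : (prefixCount α : ℤ) = ∑ π : Equiv.Perm (Fin n) with BeginsWith π α,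
      ∑ S ∈ (hitSquares α π).powerset, (-1 : ℤ) ^ #S := by
    have : prefixCount α = #{π ∈ ({π : Equiv.Perm (Fin n) | BeginsWith π α} : Finset _) |
        hitSquares α π = ∅} := by
      rw [prefixCount]
      congr 1
      ext π
      simp only [mem_filter, mem_univ, true_and]
      constructor
      · rintro ⟨h, h'⟩; exact ⟨h', (mem_menagePerms_iff hα h').1 h⟩
      · rintro ⟨h, h'⟩; exact ⟨(mem_menagePerms_iff hα h).2 h', h⟩
    rw [this, card_filter]
    push_cast
    exact sum_congr rfl fun π _ => (sum_powerset_neg_one_pow_card).symm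
  have h2 : ∀ π : Equiv.Perm (Fin n), (hitSquares α π).powerset =
      {S ∈ (derivedComplement α).powerset | ∀ p ∈ S, π (oldRow p.1) = oldColumn α p.2} := by
    intro π
    ext S
    simp only [mem_powerset, mem_filter, hitSquares, subset_iff]
    exact ⟨fun h => ⟨fun p hp => (h hp).1, fun p hp => (h hp).2⟩,
      fun h p hp => ⟨h.1 hp, h.2 p hp⟩⟩
  have h3 : ∀ S : Board (n - ℓ), #{π : Equiv.Perm (Fin n) | BeginsWith π α ∧
      ∀ p ∈ S, π (oldRow p.1) = oldColumn α p.2} =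
        if NonAttacking S then (n - ℓ - #S).factorial else 0 := by
    intro S
    have := card_perm_graph_superset (prefixSquares α ∪ S.map (oldSquare α))
    rw [card_union_of_disjoint (disjoint_prefixSquares α S), card_prefixSquares, card_map,
      ← Nat.sub_sub] at this
    simp only [nonAttacking_prefix_union] at this
    rw [← this]
    congr 1
    ext π
    simp only [mem_filter, mem_univ, true_and, beginsWith_iff, mem_union, or_imp, forall_and,
      forall_mem_map, oldSquare_apply]
  rw [h1]
  simp only [h2, sum_filter (fun S : Board (n - ℓ) => ∀ p ∈ S, _ = _)]
  rw [sum_comm]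
  have h4 : ∀ S : Board (n - ℓ), (∑ π : Equiv.Perm (Fin n) with BeginsWith π α,
      if ∀ p ∈ S, π (oldRow p.1) = oldColumn α p.2 then (-1 : ℤ) ^ #S else 0) =
      if NonAttacking S then (-1) ^ #S * ((n - ℓ - #S).factorial : ℤ) else 0 := by
    intro S
    rw [← sum_filter, filter_filter, sum_const, h3]
    split_ifs <;> simp [mul_comm]
  simp only [h4]
  rw [← sum_filter, sum_nonAttacking _ fun k => (-1) ^ k * ((n - ℓ - k).factorial : ℤ)]
  exact sum_congr rfl fun k _ => by ring


/-! ### Generating polynomials of pairwise compatible subsets -/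

section PairPoly

variable {ι κ : Type*} [DecidableEq ι] [DecidableEq κ]

open scoped Classical in
/-- The generating polynomial by cardinality of the subsets of `B` whose elements are pairwise
related by `c`. -/
noncomputable def pairPoly (c : ι → ι → Prop) (B : Finset ι) : ℤ[X] :=
  ∑ S ∈ B.powerset.filter (fun S : Finset ι => (S : Set ι).Pairwise c), X ^ #S

@[simp]
theorem pairPoly_empty (c : ι → ι → Prop) : pairPoly c ∅ = 1 := by
  classical
  simp [pairPoly, filter_singleton]

-- Deletion–contraction: a compatible set either avoids `a`, or is `a` together with a compatible
-- set inside the elements related to `a`.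
open scoped Classical in
theorem pairPoly_insert {c : ι → ι → Prop} [Std.Symm c] {a : ι} {B : Finset ι}
    (ha : a ∉ B) :
    pairPoly c (insert a B) = pairPoly c B + X * pairPoly c (B.filter (c a)) := by
  have hmem : ∀ S ∈ B.powerset, a ∉ S := fun S hS h => ha (mem_powerset.1 hS h)
  rw [pairPoly, sum_filter, sum_powerset_insert ha, ← sum_filter, ← pairPoly]
  congr 1
  rw [pairPoly, mul_sum, ← sum_filter]
  have : (B.filter (c a)).powerset.filter (fun S : Finset ι => (S : Set ι).Pairwise c) =
      B.powerset.filter (fun S : Finset ι => ((insert a S : Finset ι) : Set ι).Pairwise c) := by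
    ext S
    simp only [mem_filter, mem_powerset, coe_insert]
    constructor
    · rintro ⟨h1, h2⟩
      exact ⟨h1.trans (filter_subset _ _), h2.insert_of_symm
        fun b hb _ => (mem_filter.1 (h1 hb)).2⟩
    · rintro ⟨h1, h2⟩
      refine ⟨fun b hb => mem_filter.2 ⟨h1 hb, h2 (by simp) (by simp [hb]) ?_⟩,
        h2.mono (Set.subset_insert _ _)⟩
      rintro rfl
      exact ha (h1 hb)
  rw [this]
  refine sum_congr rfl fun S hS => ?_
  rw [card_insert_of_notMem (hmem S (mem_filter.1 hS).1), pow_succ']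

theorem pairPoly_image {c : ι → ι → Prop} {d : κ → κ → Prop} [Std.Symm c]
    [Std.Symm d] (g : ι → κ) (B : Finset ι) (hg : Set.InjOn g B)
    (hcd : ∀ p ∈ B, ∀ q ∈ B, p ≠ q → (c p q ↔ d (g p) (g q))) :
    pairPoly d (B.image g) = pairPoly c B := by
  classical
  -- Deletion–contraction leads to `A` and to a filtered subset of `A`, so the induction must cover
  -- all smaller sets.
  induction B using Finset.strongInduction with
  | H B ih =>
    rcases B.eq_empty_or_nonempty with rfl | ⟨a, ha⟩
    · simp
    obtain ⟨A, haA, rfl⟩ : ∃ A, a ∉ A ∧ insert a A = B :=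
      ⟨B.erase a, notMem_erase a B, insert_erase ha⟩
    have hA : ∀ p ∈ A, p ∈ insert a A := fun p hp => mem_insert_of_mem hp
    have ih' : ∀ A' ⊆ A, pairPoly d (A'.image g) = pairPoly c A' := fun A' hA' =>
      ih A' (lt_of_le_of_lt hA' (ssubset_insert haA))
        (hg.mono fun p hp => hA p (hA' hp))
        fun p hp q hq => hcd p (hA p (hA' hp)) q (hA q (hA' hq))
    have hnot : g a ∉ A.image g := by
      intro h
      obtain ⟨b, hb, hab⟩ := mem_image.1 h
      exact haA (hg (hA b hb) ha hab ▸ hb)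
    rw [image_insert, pairPoly_insert hnot, pairPoly_insert haA, ih' A subset_rfl,
      ← ih' _ (filter_subset _ _)]
    congr 3
    ext x
    simp only [mem_filter, mem_image]
    constructor
    · rintro ⟨⟨b, hb, rfl⟩, h⟩
      refine ⟨b, ⟨hb, (hcd a ha b (hA b hb) ?_).2 h⟩, rfl⟩
      rintro rfl; exact haA hb
    · rintro ⟨b, ⟨hb, h⟩, rfl⟩
      refine ⟨⟨b, hb, rfl⟩, (hcd a ha b (hA b hb) ?_).1 h⟩
      rintro rfl; exact haA hb

theorem pairPoly_union {c : ι → ι → Prop} [Std.Symm c] (A B : Finset ι)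
    (hd : Disjoint A B) (h : ∀ a ∈ A, ∀ b ∈ B, c a b) :
    pairPoly c (A ∪ B) = pairPoly c A * pairPoly c B := by
  classical
  induction A using Finset.strongInduction with
  | H A ih =>
    rcases A.eq_empty_or_nonempty with rfl | ⟨a, ha⟩
    · simp
    obtain ⟨A, haA, rfl⟩ : ∃ A', a ∉ A' ∧ insert a A' = A :=
      ⟨A.erase a, notMem_erase a A, insert_erase ha⟩
    have ih' : ∀ A' ⊆ A, pairPoly c (A' ∪ B) = pairPoly c A' * pairPoly c B := fun A' hA' =>
      ih A' (lt_of_le_of_lt hA' (ssubset_insert haA))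
        (hd.mono_left (hA'.trans (subset_insert _ _)))
        fun p hp => h p (mem_insert_of_mem (hA' hp))
    have haB : a ∉ B := disjoint_left.1 hd ha
    rw [insert_union, pairPoly_insert (by simp [haA, haB]), filter_union,
      filter_true_of_mem (s := B) fun b hb => h a ha b hb, ih' A subset_rfl,
      ih' _ (filter_subset _ _), pairPoly_insert haA]
    ring

theorem pairPoly_biUnion {c : ι → ι → Prop} [Std.Symm c] (s : Finset κ) (b : κ → Finset ι)
    (hd : (s : Set κ).PairwiseDisjoint b)
    (h : ∀ P ∈ s, ∀ Q ∈ s, P ≠ Q → ∀ p ∈ b P, ∀ q ∈ b Q, c p q) :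
    pairPoly c (s.biUnion b) = ∏ P ∈ s, pairPoly c (b P) := by
  induction s using Finset.induction with
  | empty => simp
  | insert a s ha ih =>
    have hne : ∀ Q ∈ s, a ≠ Q := by rintro Q hQ rfl; exact ha hQ
    rw [biUnion_insert, prod_insert ha, pairPoly_union, ih]
    · exact hd.subset (by simp)
    · exact fun P hP Q hQ => h P (by simp [hP]) Q (by simp [hQ])
    · rw [disjoint_biUnion_right]
      exact fun Q hQ => hd (by simp) (by simp [hQ]) (hne Q hQ)
    · intro p hp q hq
      obtain ⟨Q, hQ, hq⟩ := mem_biUnion.1 hq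
      exact h a (by simp) Q (by simp [hQ]) (hne Q hQ) p hp q hq

end PairPoly

/-- The independence polynomial of a path. -/
theorem pairPoly_Ico (a N : ℕ) :
    pairPoly (fun s t : ℕ => s + 2 ≤ t ∨ t + 2 ≤ s) (Ico a (a + N)) = fibPoly N := by
  have : Std.Symm (fun s t : ℕ => s + 2 ≤ t ∨ t + 2 ≤ s) := ⟨fun s t h => h.symm⟩
  induction N using Nat.twoStepInduction with
  | zero => simp [fibPoly]
  | one =>
    have : Ico a (a + 1) = insert a ∅ := by simp
    rw [this, pairPoly_insert (by simp)]
    simp [fibPoly]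
  | more N ih1 ih2 =>
    -- Deleting the top vertex leaves `N + 1` vertices; using it also excludes its neighbour and
    -- leaves `N`.
    have : Ico a (a + (N + 2)) = insert (a + (N + 1)) (Ico a (a + (N + 1))) := by
      ext; simp; omega
    rw [this, pairPoly_insert (by simp), ih2, fibPoly, ← ih1, add_comm]
    congr 3
    ext
    simp
    omega

/-! ### Staircases -/

theorem mem_stairO {s : ℕ} {p : ℕ × ℕ} :
    p ∈ stairO s ↔ (p.1 < s ∧ p.2 = p.1) ∨ (p.1 < s - 1 ∧ p.2 = p.1 + 1) := by
  obtain ⟨x, y⟩ := p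
  simp only [stairO, mem_union, mem_image, mem_range, Prod.mk.injEq]
  grind

theorem mem_stairOT {s : ℕ} {p : ℕ × ℕ} :
    p ∈ stairOT s ↔ (p.2 < s ∧ p.1 = p.2) ∨ (p.2 < s - 1 ∧ p.1 = p.2 + 1) := by
  obtain ⟨x, y⟩ := p
  simp only [stairOT, mem_union, mem_image, mem_range, Prod.mk.injEq]
  grind

theorem mem_stairE {s : ℕ} {p : ℕ × ℕ} :
    p ∈ stairE s ↔ (p.2 < s - 1 ∧ p.1 = p.2) ∨ (p.2 < s - 1 ∧ p.1 = p.2 + 1) := by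
  obtain ⟨x, y⟩ := p
  simp only [stairE, mem_union, mem_image, mem_range, Prod.mk.injEq]
  grind

theorem mem_stairET {s : ℕ} {p : ℕ × ℕ} :
    p ∈ stairET s ↔ (p.1 < s - 1 ∧ p.2 = p.1) ∨ (p.1 < s - 1 ∧ p.2 = p.1 + 1) := by
  obtain ⟨x, y⟩ := p
  simp only [stairET, mem_union, mem_image, mem_range, Prod.mk.injEq]
  grind

/-- The squares `((t + 1) / 2, t / 2)` with `t` in an interval form a staircase. -/
theorem exists_stair_eq_image_Ico (lo hi : ℕ) :
    ∃ s, 1 ≤ s ∧ ∃ T ∈ [stairO s, stairOT s, stairE s, stairET s],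
      T = (Ico lo hi).image fun t => ((t + 1) / 2 - (lo + 1) / 2, t / 2 - lo / 2) := by
  rcases le_or_gt hi lo with h | h
  -- An empty block counts as a staircase, since `stairE 1` has no squares.
  · exact ⟨1, le_rfl, stairE 1, by simp, by simp [stairE, Ico_eq_empty_of_le h]⟩
  -- Even positions lie on the main diagonal and odd ones just below it, so the parities of the two
  -- ends select the shape. In each case `t` is recovered as `lo` plus the coordinate sum.
  rcases Nat.even_or_odd' lo with ⟨u, rfl | rfl⟩ <;> rcases Nat.even_or_odd' hi with ⟨v, rfl | rfl⟩
  · refine ⟨v - u + 1, by omega, stairE (v - u + 1), by simp, ?_⟩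
    ext ⟨x, y⟩
    simp only [mem_stairE, mem_image, mem_Ico, Prod.mk.injEq]
    exact ⟨fun _ => ⟨2 * u + x + y, by omega⟩, by rintro ⟨t, ht⟩; omega⟩
  · refine ⟨v - u + 1, by omega, stairOT (v - u + 1), by simp, ?_⟩
    ext ⟨x, y⟩
    simp only [mem_stairOT, mem_image, mem_Ico, Prod.mk.injEq]
    exact ⟨fun _ => ⟨2 * u + x + y, by omega⟩, by rintro ⟨t, ht⟩; omega⟩
  · refine ⟨v - u, by omega, stairO (v - u), by simp, ?_⟩
    ext ⟨x, y⟩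
    simp only [mem_stairO, mem_image, mem_Ico, Prod.mk.injEq]
    exact ⟨fun _ => ⟨2 * u + 1 + x + y, by omega⟩, by rintro ⟨t, ht⟩; omega⟩
  · refine ⟨v - u + 1, by omega, stairET (v - u + 1), by simp, ?_⟩
    ext ⟨x, y⟩
    simp only [mem_stairET, mem_image, mem_Ico, Prod.mk.injEq]
    exact ⟨fun _ => ⟨2 * u + 1 + x + y, by omega⟩, by rintro ⟨t, ht⟩; omega⟩


/-! ### Contiguous parts -/

section ContiguousParts

variable {n : ℕ} {S P Q : Finset (Fin n)} {x y : Fin n}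

theorem subset_of_mem_contiguousParts (hP : P ∈ contiguousParts S) : P ⊆ S := by
  obtain ⟨i, -, rfl⟩ := mem_image.1 hP
  exact filter_subset _ _

theorem exists_mem_contiguousParts (hx : x ∈ S) : ∃ P ∈ contiguousParts S, x ∈ P :=
  ⟨_, mem_image_of_mem _ hx, by simp [hx]⟩

/-- Being joined by an interval inside `S` is an equivalence relation, so any element of a part may
serve as its base point. -/
theorem mem_part_iff (hP : P ∈ contiguousParts S) (hx : x ∈ P) :
    y ∈ P ↔ y ∈ S ∧ uIcc x y ⊆ S := by
  obtain ⟨i, hi, rfl⟩ := mem_image.1 hP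
  obtain ⟨hxS, hix⟩ := mem_filter.1 hx
  rw [mem_filter]
  refine and_congr_right fun hy => ⟨fun h => ?_, fun h => ?_⟩
  · refine (uIcc_subset_uIcc_union_uIcc (b := i)).trans (union_subset ?_ h)
    rwa [uIcc_comm]
  · exact (uIcc_subset_uIcc_union_uIcc (b := x)).trans (union_subset hix h)

theorem eq_of_mem_contiguousParts (hP : P ∈ contiguousParts S) (hQ : Q ∈ contiguousParts S)
    (hxP : x ∈ P) (hxQ : x ∈ Q) : P = Q := by
  ext y
  rw [mem_part_iff hP hxP, mem_part_iff hQ hxQ]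

theorem mem_part_of_val_succ (hP : P ∈ contiguousParts S) (hx : x ∈ P) (hy : y ∈ S)
    (hxy : (y : ℕ) = x + 1 ∨ (x : ℕ) = y + 1) : y ∈ P := by
  refine (mem_part_iff hP hx).2 ⟨hy, fun z hz => ?_⟩
  have hxS := subset_of_mem_contiguousParts hP hx
  have : z = x ∨ z = y := by
    rw [mem_uIcc', Fin.le_def, Fin.le_def, Fin.le_def, Fin.le_def] at hz
    rw [Fin.ext_iff, Fin.ext_iff]
    omega
  rcases this with rfl | rfl <;> assumption

theorem exists_eq_Icc (hP : P ∈ contiguousParts S) : ∃ a b, a ≤ b ∧ P = Icc a b := by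
  have hne : P.Nonempty := by
    obtain ⟨i, hi, rfl⟩ := mem_image.1 hP
    exact ⟨i, by simp [hi]⟩
  refine ⟨P.min' hne, P.max' hne, P.min'_le_max' hne, ?_⟩
  ext z
  rw [mem_Icc]
  refine ⟨fun hz => ⟨P.min'_le z hz, P.le_max' z hz⟩, fun hz => ?_⟩
  have hsub := ((mem_part_iff hP (P.min'_mem hne)).1 (P.max'_mem hne)).2
  rw [uIcc_of_le (P.min'_le_max' hne)] at hsub
  refine (mem_part_iff hP (P.min'_mem hne)).2 ⟨hsub (mem_Icc.2 hz), ?_⟩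
  rw [uIcc_of_le hz.1]
  exact (Icc_subset_Icc_right hz.2).trans hsub

end ContiguousParts

/-! ### The blocks of the derived complementary board -/

section Blocks

variable {n ℓ : ℕ} {α : Fin ℓ ↪ Fin n}

theorem mem_derivedComplement (hℓ : 1 ≤ ℓ) {p : Fin (n - ℓ) × Fin (n - ℓ)} :
    p ∈ derivedComplement α ↔
      (oldColumn α p.2 : ℕ) = ℓ + p.1 ∨ (oldColumn α p.2 : ℕ) + 1 = ℓ + p.1 := by
  have hlt : ℓ + p.1 < n := by omega
  have hmod : ((oldColumn α p.2 : ℕ) + 1 ≡ ℓ + p.1 [MOD n]) ↔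
      (oldColumn α p.2 : ℕ) + 1 = ℓ + p.1 := by
    constructor
    · intro h
      rcases (Nat.succ_le_of_lt (oldColumn α p.2).2).lt_or_eq with hc | hc
      · exact h.eq_of_lt_of_lt hc hlt
      -- The last column would wrap around to row `0`, but `ℓ + p.1` is positive.
      · rw [Nat.succ_eq_add_one] at hc
        rw [hc, Nat.ModEq, Nat.mod_self, Nat.mod_eq_of_lt hlt] at h
        omega
    · intro h; rw [h]
  simp only [derivedComplement, derivedBoard, menageBoard, mem_compl, mem_filter, mem_univ,
    true_and, Allowed, oldRow, hmod, Ne, Fin.ext_iff]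
  tauto

/-- The position of a square in the chain `(0, 0), (1, 0), (1, 1), (2, 1), …` of squares of the
original board, if it belongs to this chain. -/
def chainPos (α : Fin ℓ ↪ Fin n) (p : Fin (n - ℓ) × Fin (n - ℓ)) : ℕ :=
  ℓ + p.1 + oldColumn α p.2

theorem mem_derivedComplement_iff_chainPos (hℓ : 1 ≤ ℓ) {p : Fin (n - ℓ) × Fin (n - ℓ)} :
    p ∈ derivedComplement α ↔
      ℓ + p.1 = (chainPos α p + 1) / 2 ∧ (oldColumn α p.2 : ℕ) = chainPos α p / 2 := by
  rw [mem_derivedComplement hℓ, chainPos]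
  omega

theorem chainPos_injOn (hℓ : 1 ≤ ℓ) :
    Set.InjOn (chainPos α) (derivedComplement α : Set (Fin (n - ℓ) × Fin (n - ℓ))) := by
  intro p hp q hq h
  rw [mem_coe, mem_derivedComplement_iff_chainPos hℓ] at hp hq
  rw [h] at hp
  exact Prod.ext (Fin.ext (by omega))
    ((oldColumn_strictMono α).injective (Fin.ext (by omega)))

/-- Two squares of the complementary board do not attack each other if and only if they are not
neighbours in the chain. -/
theorem not_attack_iff (hℓ : 1 ≤ ℓ) {p q : Fin (n - ℓ) × Fin (n - ℓ)}
    (hp : p ∈ derivedComplement α) (hq : q ∈ derivedComplement α) :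
    (p.1 ≠ q.1 ∧ p.2 ≠ q.2) ↔
      (chainPos α p + 2 ≤ chainPos α q ∨ chainPos α q + 2 ≤ chainPos α p) := by
  rw [mem_derivedComplement_iff_chainPos hℓ] at hp hq
  rw [← (oldColumn_strictMono α).injective.ne_iff (x := p.2), Ne, Ne, Fin.ext_iff, Fin.ext_iff]
  omega

/-- The squares of the derived complementary board in the columns of `P`. -/
def block (α : Fin ℓ ↪ Fin n) (P : Finset (Fin n)) : Board (n - ℓ) :=
  {p ∈ derivedComplement α | oldColumn α p.2 ∈ P}

/-- The end positions `2 * ℓ - 1` and `2 * n - 2` belong to the squares `(ℓ, ℓ - 1)` and `(n - 1, n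
- 1)`. -/
theorem image_chainPos_block (hℓ : 1 ≤ ℓ) {P : Finset (Fin n)} (hP : P ⊆ freeColumns α) :
    (block α P).image (chainPos α) =
      {t ∈ Ico (2 * ℓ - 1) (2 * n - 1) | ∃ x ∈ P, (x : ℕ) = t / 2} := by
  ext t
  simp only [mem_image, mem_filter, mem_Ico, block]
  constructor
  · rintro ⟨p, ⟨hp, hpP⟩, rfl⟩
    rw [mem_derivedComplement_iff_chainPos hℓ] at hp
    exact ⟨by omega, _, hpP, hp.2⟩
  · rintro ⟨ht, x, hx, hxt⟩
    obtain ⟨j, rfl⟩ := exists_oldColumn α (hP hx)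
    have hpos : chainPos α (⟨(t + 1) / 2 - ℓ, by omega⟩, j) = t := by
      simp only [chainPos]
      omega
    refine ⟨_, ⟨(mem_derivedComplement_iff_chainPos hℓ).2 ?_, hx⟩, hpos⟩
    rw [hpos]
    exact ⟨by dsimp only; omega, hxt⟩

theorem card_block (hℓ : 1 ≤ ℓ) {P : Finset (Fin n)} (hP : P ⊆ freeColumns α) :
    #(block α P) = blockSize ℓ P := by
  have hb : block α P ⊆ derivedComplement α := filter_subset _ _
  rw [← card_image_of_injOn ((chainPos_injOn hℓ).mono (coe_subset.2 hb)),
    image_chainPos_block hℓ hP, blockSize]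
  -- Column `x` carries the positions `2 * x` and `2 * x + 1`. Clipping removes one of them at `x =
  -- ℓ - 1` and at `x = n - 1`, and both when `x < ℓ - 1`, which gives `columnSize`.
  have hbi : {t ∈ Ico (2 * ℓ - 1) (2 * n - 1) | ∃ x ∈ P, (x : ℕ) = t / 2} =
      P.biUnion fun x => Ico (max (2 * ℓ - 1) (2 * x)) (min (2 * n - 1) (2 * x + 2)) := by
    ext t
    simp only [mem_filter, mem_Ico, mem_biUnion, max_le_iff, lt_min_iff]
    constructor
    · rintro ⟨ht, x, hx, hxt⟩
      exact ⟨x, hx, by omega⟩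
    · rintro ⟨x, hx, ht⟩
      exact ⟨by omega, x, hx, by omega⟩
  rw [hbi, card_biUnion]
  · refine sum_congr rfl fun x hx => ?_
    have hℓn : ℓ < n := by
      have := card_pos.2 ⟨x, hP hx⟩
      rw [card_freeColumns] at this
      omega
    have := x.2
    rw [Nat.card_Ico, columnSize]
    split_ifs <;> omega
  · intro x _ y _ hxy
    rw [Function.onFun, disjoint_left]
    intro t ht ht'
    rw [mem_Ico] at ht ht'
    exact hxy (Fin.ext (by omega))

/-- The interval of chain positions of the block of an interval of columns. -/
theorem image_chainPos_block_Icc (hℓ : 1 ≤ ℓ) {a b : Fin n} (h : Icc a b ⊆ freeColumns α) :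
    (block α (Icc a b)).image (chainPos α) =
      Ico (max (2 * ℓ - 1) (2 * a)) (min (2 * n - 1) (2 * b + 2)) := by
  rw [image_chainPos_block hℓ h]
  ext t
  simp only [mem_filter, mem_Ico, mem_Icc, Fin.le_def]
  constructor
  · rintro ⟨ht, x, hx, hxt⟩
    omega
  · intro ht
    exact ⟨by omega, ⟨t / 2, by omega⟩, by dsimp only; omega, rfl⟩

/-- Reindexing shifts a run of consecutive free columns rigidly; this makes the block a translate of
its image in the original board. -/
theorem oldColumn_index_add {j₀ : Fin (n - ℓ)} (k : ℕ) (j : Fin (n - ℓ))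
    (hk : (oldColumn α j : ℕ) = oldColumn α j₀ + k)
    (hsub : Icc (oldColumn α j₀) (oldColumn α j) ⊆ freeColumns α) : (j : ℕ) = j₀ + k := by
  induction k generalizing j with
  | zero => rw [(oldColumn_strictMono α).injective (Fin.ext hk)]; rfl
  | succ k ih =>
    have hlt := (oldColumn α j).2
    obtain ⟨i, hi⟩ := exists_oldColumn α (x := ⟨oldColumn α j₀ + k, by omega⟩)
      (hsub (by rw [mem_Icc, Fin.le_def, Fin.le_def]; dsimp only; omega))
    have hi' := congrArg Fin.val hi
    dsimp only at hi'
    have hik := ih i hi' ((Icc_subset_Icc_right (by rw [Fin.le_def]; omega)).trans hsub)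
    have hij : i < j := (oldColumn_strictMono α).lt_iff_lt.1 (by rw [Fin.lt_def]; omega)
    rw [Fin.lt_def] at hij
    -- Otherwise index `i + 1` would lie strictly before `j`, and its column strictly between two
    -- consecutive columns.
    by_contra hne
    have h1 := oldColumn_strictMono α (a := i) (b := ⟨i + 1, by omega⟩) (by simp [Fin.lt_def])
    have h2 := oldColumn_strictMono α (a := ⟨i + 1, by omega⟩) (b := j)
      (by rw [Fin.lt_def]; dsimp only; omega)
    rw [Fin.lt_def] at h1 h2
    omega

theorem isStaircase_block (hℓ : 1 ≤ ℓ) {a b : Fin n} (hab : a ≤ b)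
    (h : Icc a b ⊆ freeColumns α) : IsStaircase (block α (Icc a b)) := by
  obtain ⟨j₀, hj₀⟩ := exists_oldColumn α (h (left_mem_Icc.2 hab))
  set lo := max (2 * ℓ - 1) (2 * (a : ℕ)) with hlo
  obtain ⟨s, hs, T, hT, hTeq⟩ := exists_stair_eq_image_Ico lo (min (2 * n - 1) (2 * b + 2))
  -- The first chain square is `((lo + 1) / 2, lo / 2)`. Its row drops by `ℓ`, and its column lies
  -- `lo / 2 - a` places after column `a`, whose new index is `j₀`.
  refine ⟨s, (lo + 1) / 2 - ℓ, lo / 2 - a + j₀, hs, T, hT, ?_⟩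
  rw [hTeq, ← image_chainPos_block_Icc hℓ h, image_image, image_image]
  refine image_congr fun p hp => ?_
  have hpos : chainPos α p ∈ Ico lo (min (2 * n - 1) (2 * b + 2)) := by
    rw [← image_chainPos_block_Icc hℓ h]
    exact mem_image_of_mem _ hp
  obtain ⟨hpc, hpI⟩ := mem_filter.1 hp
  rw [mem_derivedComplement_iff_chainPos hℓ] at hpc
  rw [mem_Icc, Fin.le_def, Fin.le_def] at hpI
  have hidx := oldColumn_index_add (α := α) (j₀ := j₀) (oldColumn α p.2 - a) p.2
    (by rw [hj₀]; omega)
    (by rw [hj₀]; exact (Icc_subset_Icc_right (Fin.le_def.2 hpI.2)).trans h)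
  rw [mem_Ico] at hpos
  simp only [Function.comp, Prod.mk.injEq]
  omega

/-- Columns are separated because parts are disjoint. Two forbidden squares in one row lie in equal
or adjacent columns, and free columns that are equal or adjacent belong to the same part. -/
theorem disjointBoards_block (hℓ : 1 ≤ ℓ) {P Q : Finset (Fin n)}
    (hP : P ∈ contiguousParts (freeColumns α)) (hQ : Q ∈ contiguousParts (freeColumns α))
    (hPQ : P ≠ Q) : DisjointBoards (block α P) (block α Q) := by
  intro p hp q hq
  obtain ⟨hp, hpP⟩ := mem_filter.1 hp
  obtain ⟨hq, hqQ⟩ := mem_filter.1 hq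
  have hne : ∀ x ∈ P, x ∉ Q := fun x hx hx' => hPQ (eq_of_mem_contiguousParts hP hQ hx hx')
  refine ⟨fun h => ?_, fun h => hne _ hpP (h ▸ hqQ)⟩
  rw [mem_derivedComplement hℓ] at hp hq
  rw [h] at hp
  have h' : oldColumn α p.2 ≠ oldColumn α q.2 := fun h' => hne _ hpP (h' ▸ hqQ)
  rw [Ne, Fin.ext_iff] at h'
  exact hne _ (mem_part_of_val_succ hP hpP (oldColumn_mem α q.2) (by omega)) hqQ

theorem isBlockDecomposition_block (hℓ : 1 ≤ ℓ) : IsBlockDecomposition α (block α) where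
  staircase P hP := by
    obtain ⟨a, b, hab, rfl⟩ := exists_eq_Icc hP
    exact isStaircase_block hℓ hab (subset_of_mem_contiguousParts hP)
  disjoint P hP Q hQ hPQ := disjointBoards_block hℓ hP hQ hPQ
  union := by
    ext p
    simp only [mem_biUnion, block, mem_filter]
    refine ⟨fun ⟨P, _, hp, _⟩ => hp, fun hp => ?_⟩
    obtain ⟨P, hP, hpP⟩ := exists_mem_contiguousParts (oldColumn_mem α p.2)
    exact ⟨P, hP, hp, hpP⟩

/-! ### Factorization of the rook polynomial. -/

theorem rookPolynomial_eq_pairPoly {m : ℕ} (B : Board m) :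
    rookPolynomial B = pairPoly (fun p q => p.1 ≠ q.1 ∧ p.2 ≠ q.2) B := by
  have := sum_nonAttacking B fun k => (X : ℤ[X]) ^ k
  simp only [rookPolynomial, pairPoly, map_natCast]
  rw [← this]
  refine sum_congr ?_ fun _ _ => rfl
  ext S
  simp only [mem_filter]
  rfl

instance symm_nonAttacking {m : ℕ} :
    Std.Symm fun p q : Fin m × Fin m => p.1 ≠ q.1 ∧ p.2 ≠ q.2 :=
  ⟨fun _ _ h => ⟨h.1.symm, h.2.symm⟩⟩

/-- `chainPos` carries nonattacking squares to nonadjacent positions, so the block becomes a path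
whose number of vertices is the block size. -/
theorem pairPoly_block (hℓ : 1 ≤ ℓ) {P : Finset (Fin n)}
    (hP : P ∈ contiguousParts (freeColumns α)) :
    pairPoly (fun p q => p.1 ≠ q.1 ∧ p.2 ≠ q.2) (block α P) = fibPoly (blockSize ℓ P) := by
  have hsub := subset_of_mem_contiguousParts hP
  have hb : block α P ⊆ derivedComplement α := filter_subset _ _
  have hinj := (chainPos_injOn (α := α) hℓ).mono (coe_subset.2 hb)
  have : Std.Symm (fun s t : ℕ => s + 2 ≤ t ∨ t + 2 ≤ s) := ⟨fun s t h => h.symm⟩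
  rw [← card_block hℓ hsub, ← card_image_of_injOn hinj,
    ← pairPoly_image (d := fun s t : ℕ => s + 2 ≤ t ∨ t + 2 ≤ s) (chainPos α) _ hinj
      fun p hp q hq _ => not_attack_iff hℓ (hb hp) (hb hq)]
  obtain ⟨a, b, hab, rfl⟩ := exists_eq_Icc hP
  rw [image_chainPos_block_Icc hℓ hsub, Nat.card_Ico]
  set lo := max (2 * ℓ - 1) (2 * (a : ℕ))
  set hi := min (2 * n - 1) (2 * (b : ℕ) + 2)
  rcases le_total lo hi with h | h
  · rw [← pairPoly_Ico lo, Nat.add_sub_cancel' h]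
  -- When clipping leaves nothing, the truncated difference is `0`, which matches `fibPoly 0 = 1`.
  · rw [Nat.sub_eq_zero_of_le h, Ico_eq_empty_of_le h, pairPoly_empty, fibPoly]

theorem rookPolynomial_derivedComplement (hℓ : 1 ≤ ℓ) :
    rookPolynomial (derivedComplement α) = ((blockSizes α).map fibPoly).prod := by
  rw [rookPolynomial_eq_pairPoly, ← (isBlockDecomposition_block (α := α) hℓ).union,
    pairPoly_biUnion, blockSizes, Multiset.map_map]
  · exact prod_congr rfl fun P hP => pairPoly_block hℓ hP
  · intro P hP Q hQ hPQ
    rw [Function.onFun, disjoint_left]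
    exact fun p hp hq => (disjointBoards_block hℓ hP hQ hPQ p hp p hq).1 rfl
  · exact fun P hP Q hQ hPQ => disjointBoards_block hℓ hP hQ hPQ

end Blocks

end Menage

theorem mainTheorem1 (n ℓ : ℕ) (hℓ : 1 ≤ ℓ) (α : Fin ℓ ↪ Fin n) (hα : Menage.ValidPrefix α) :
    (∃ b : Finset (Fin n) → Menage.Board (n - ℓ),
      Menage.IsBlockDecomposition α b ∧
      ∀ P ∈ Menage.contiguousParts (Menage.freeColumns α),
        (b P).card = Menage.blockSize ℓ P) ∧
    Menage.rookPolynomial (Menage.derivedComplement α) =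
      ((Menage.blockSizes α).map Menage.fibPoly).prod ∧
    (Menage.prefixCount α : ℤ) =
      ∑ k ∈ Finset.range (n - ℓ + 1),
        (-1) ^ k * (Menage.rookNumber (Menage.derivedComplement α) k : ℤ) *
          ((n - ℓ - k).factorial : ℤ) :=
  ⟨⟨Menage.block α, Menage.isBlockDecomposition_block hℓ, fun _ hP =>
      Menage.card_block hℓ (Menage.subset_of_mem_contiguousParts hP)⟩,
    Menage.rookPolynomial_derivedComplement hℓ, Menage.prefixCount_eq hα⟩
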